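/- **Theorem 2.** Let $n \ge 0$. Let $\Lambda\mathbb{C}^n$ be the exterior algebra of $\mathbb{C}^n$, with the inner product for which the vectors $e_{i_1}\wedge\cdots\wedge e_{i_p}$ ($i_1<\cdots<i_p$) are orthonormal, where $e_1,\dots,e_n$ is the standard basis of $\mathbb{C}^n$, and let $\mathrm{U}(\Lambda\mathbb{C}^n)$ be its unitary group. Let $\rho\colon \mathrm{SU}(n)\to \mathrm{U}(\Lambda\mathbb{C}^n)$ be the natural representation: $\rho(g)$ is the algebra automorphism of $\Lambda\mathbb{C}^n$ that extends the action of $g$ on $\mathbb{C}^n$. Let $a_j^*\psi = e_j\wedge\psi$ be the creation operators on $\Lambda\mathbb{C}^n$, $a_j$ their adjoints (the annihilation operators), and put $$\phi_j = i(a_j+a_j^*),\qquad \pi_j = a_j-a_j^*\qquad (1\le j\le n).$$ Let $\mathrm{Cliff}_{2n}$ be the associative real algebra generated by $\mathbb{R}^{2n}$ with the relations $vw+wv=-2\langle v,w\rangle$, and let $\mathrm{Spin}(2n)\subset \mathrm{Cliff}_{2n}$ be the multiplicative group generated by the products of pairs of unit vectors. The operators $\phi_1,\dots,\phi_n,\pi_1,\dots,\pi_n$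 anticommute and square to $-1$, so sending the standard basis vectors $\gamma_1,\dots,\gamma_{2n}$ of $\mathbb{R}^{2n}$ to them, in any chosen order, makes $\Lambda\mathbb{C}^n$ a $\mathrm{Cliff}_{2n}$-module. Restricting this action to $\mathrm{Spin}(2n)$ gives the Dirac spinor representation $\rho'\colon\mathrm{Spin}(2n)\to\mathrm{U}(\Lambda\mathbb{C}^n)$. For every choice of the order there exists a Lie group homomorphism $\psi\colon \mathrm{SU}(n)\to\mathrm{Spin}(2n)$ such that $\rho'\circ\psi=\rho$. -/

import Mathlib

open scoped ContDiff

namespace SpinorRep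

/-! ### The exterior algebra of `ℂⁿ` as a Hilbert space -/

/-- The exterior algebra `Λ ℂⁿ`. -/
abbrev ExtAlg (n : ℕ) : Type := ExteriorAlgebra ℂ (Fin n → ℂ)

/-- The basis of `Λ ℂⁿ` induced by the standard basis `e_1, …, e_n` of `ℂⁿ`: the basis vector of
`S = {i_1 < ⋯ < i_p}` is `e_{i_1} ∧ ⋯ ∧ e_{i_p}`. -/
noncomputable def extBasis (n : ℕ) : Module.Basis (Finset (Fin n)) ℂ (ExtAlg n) :=
  (Pi.basisFun ℂ (Fin n)).ExteriorAlgebra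

/-- The inner product on `Λ ℂⁿ` for which the induced basis is orthonormal, conjugate linear in the
first argument. -/
noncomputable def extInner {n : ℕ} (x y : ExtAlg n) : ℂ :=
  ∑ S : Finset (Fin n), star ((extBasis n).repr x S) * (extBasis n).repr y S

/-- The unitary group `U(Λ ℂⁿ)`: the invertible complex-linear operators on `Λ ℂⁿ` that preserve
the inner product. -/
def ExtUnitary (n : ℕ) : Subgroup (LinearMap.GeneralLinearGroup ℂ (ExtAlg n)) where
  carrier := {u | ∀ x y : ExtAlg n,
    extInner ((u : Module.End ℂ (ExtAlg n)) x) ((u : Module.End ℂ (ExtAlg n)) y) = extInner x y}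
  one_mem' _ _ := rfl
  mul_mem' := by
    intro u v hu hv x y
    simp only [Units.val_mul, Module.End.mul_apply]
    rw [hu, hv]
  inv_mem' := by
    intro u hu x y
    have h : ∀ z : ExtAlg n, (u : Module.End ℂ (ExtAlg n)) ((↑u⁻¹ : Module.End ℂ (ExtAlg n)) z) = z :=
      fun z => by rw [← Module.End.mul_apply, Units.mul_inv, Module.End.one_apply]
    rw [← hu, h, h]

/-! ### Creation and annihilation operators -/

/-- The creation operator `a_j^* : x ↦ e_j ∧ x`. -/
noncomputable def creation {n : ℕ} (j : Fin n) : Module.End ℂ (ExtAlg n) :=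
  LinearMap.mulLeft ℂ (ExteriorAlgebra.ι ℂ (Pi.single j 1))

/-- The annihilation operator `a_j`: contraction with the `j`-th coordinate form, so that
`a_j (e_{i_1} ∧ ⋯ ∧ e_{i_p}) = (-1)^(k+1) e_{i_1} ∧ ⋯ (omit e_{i_k}) ⋯ ∧ e_{i_p}` if `j = i_k`, and
`0` if `j` does not occur. It is the adjoint of `creation j`, see `extInner_creation_left`. -/
noncomputable def annihilation {n : ℕ} (j : Fin n) : Module.End ℂ (ExtAlg n) :=
  CliffordAlgebra.contractLeft (Q := (0 : QuadraticForm ℂ (Fin n → ℂ))) (LinearMap.proj j)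

section Inner

variable {n : ℕ}

theorem extInner_add_left (x x' y : ExtAlg n) :
    extInner (x + x') y = extInner x y + extInner x' y := by
  simp [extInner, add_mul, Finset.sum_add_distrib]

theorem extInner_add_right (x y y' : ExtAlg n) :
    extInner x (y + y') = extInner x y + extInner x y' := by
  simp [extInner, mul_add, Finset.sum_add_distrib]

theorem extInner_smul_left (c : ℂ) (x y : ExtAlg n) :
    extInner (c • x) y = star c * extInner x y := by
  simp [extInner, Finset.mul_sum, mul_assoc]

theorem extInner_smul_right (c : ℂ) (x y : ExtAlg n) :
    extInner x (c • y) = c * extInner x y := by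
  simp only [extInner, map_smul, Finsupp.smul_apply, smul_eq_mul, Finset.mul_sum]
  exact Finset.sum_congr rfl fun _ _ => by ring

theorem extInner_basis (S T : Finset (Fin n)) :
    extInner (extBasis n S) (extBasis n T) = if S = T then 1 else 0 := by
  simp [extInner, Finsupp.single_apply]

theorem extInner_star (x y : ExtAlg n) : star (extInner x y) = extInner y x := by
  simp [extInner, mul_comm]

theorem contractLeft_ιMulti_eq_zero (d : Module.Dual ℂ (Fin n → ℂ)) (p : ℕ) (v : Fin p → Fin n → ℂ)
    (h : ∀ i, d (v i) = 0) :
    CliffordAlgebra.contractLeft (Q := (0 : QuadraticForm ℂ (Fin n → ℂ))) d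
      (ExteriorAlgebra.ιMulti ℂ p v) = 0 := by
  induction p with
  | zero => rw [ExteriorAlgebra.ιMulti_zero_apply]; exact CliffordAlgebra.contractLeft_one _ d
  | succ p ih =>
    rw [ExteriorAlgebra.ιMulti_succ_apply]
    refine (CliffordAlgebra.contractLeft_ι_mul d _ _).trans ?_
    rw [h 0, zero_smul]
    have := ih (Matrix.vecTail v) (fun i => h i.succ)
    rw [this, mul_zero, sub_zero]

theorem annihilation_basis_of_notMem (j : Fin n) (S : Finset (Fin n)) (h : j ∉ S) :
    annihilation j (extBasis n S) = 0 := by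
  rw [extBasis, ExteriorAlgebra.basis_apply]
  refine contractLeft_ιMulti_eq_zero _ _ _ fun i => ?_
  have hi := (Set.powersetCard.mem_range_ofFinEmbEquiv_symm_iff_mem
    (Set.powersetCard.prodEquiv.symm S).2 _).1 ⟨i, rfl⟩
  have hi' : Set.powersetCard.ofFinEmbEquiv.symm (Set.powersetCard.prodEquiv.symm S).2 i ∈ S := hi
  have hne : Set.powersetCard.ofFinEmbEquiv.symm (Set.powersetCard.prodEquiv.symm S).2 i ≠ j := by
    rintro rfl
    exact h hi'
  simp only [Function.comp_apply, LinearMap.proj_apply, Pi.basisFun_apply]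
  exact Pi.single_eq_of_ne hne.symm 1

theorem extBasis_empty : extBasis n ∅ = 1 := by
  rw [extBasis, ExteriorAlgebra.basis_apply_ofCard _ (Finset.card_empty)]
  exact ExteriorAlgebra.ιMulti_zero_apply _

theorem extBasis_singleton (j : Fin n) :
    extBasis n {j} = ExteriorAlgebra.ι ℂ (Pi.single j 1) := by
  rw [extBasis, ExteriorAlgebra.basis_apply_ofCard _ (Finset.card_singleton j)]
  have hi := (Set.powersetCard.mem_range_ofFinEmbEquiv_symm_iff_mem
    (Set.powersetCard.ofCard (Finset.card_singleton j)) _).1 ⟨0, rfl⟩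
  have hi' : Set.powersetCard.ofFinEmbEquiv.symm
      (Set.powersetCard.ofCard (Finset.card_singleton j)) 0 ∈ ({j} : Finset (Fin n)) := hi
  rw [Finset.mem_singleton] at hi'
  simp [ExteriorAlgebra.ιMulti_family, ExteriorAlgebra.ιMulti_apply, hi']

theorem creation_basis_of_mem (j : Fin n) (S : Finset (Fin n)) (h : j ∈ S) :
    creation j (extBasis n S) = 0 := by
  have := ExteriorAlgebra.basis_mul_of_not_disjoint (Pi.basisFun ℂ (Fin n))
    (Set.powersetCard.ofCard (Finset.card_singleton j)) (Set.powersetCard.ofCard (s := S) rfl)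
    (by simpa using h)
  rw [creation, LinearMap.mulLeft_apply, ← extBasis_singleton]
  exact this

theorem creation_basis_of_notMem (j : Fin n) (S : Finset (Fin n)) (h : j ∉ S) :
    ∃ s : ℝ, s * s = 1 ∧ creation j (extBasis n S) = (s : ℂ) • extBasis n (insert j S) := by
  have hd : Disjoint (Set.powersetCard.ofCard (Finset.card_singleton j)).val
      (Set.powersetCard.ofCard (s := S) rfl).val := by simpa using h
  have := ExteriorAlgebra.basis_mul_of_disjoint (Pi.basisFun ℂ (Fin n)) _ _ hd
  refine ⟨((Set.powersetCard.permOfDisjoint hd).sign : ℤ), ?_, ?_⟩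
  · rcases Int.units_eq_one_or (Set.powersetCard.permOfDisjoint hd).sign with hs | hs <;> simp [hs]
  · rw [creation, LinearMap.mulLeft_apply, ← extBasis_singleton]
    refine this.trans ?_
    have hU : (Set.powersetCard.disjUnion hd : Finset (Fin n)) = insert j S := by
      ext i
      simp [Set.powersetCard.disjUnion]
    rw [hU]
    rcases Int.units_eq_one_or (Set.powersetCard.permOfDisjoint hd).sign with hs | hs <;>
      simp [hs, extBasis]

theorem annihilation_creation (j : Fin n) (x : ExtAlg n) :
    annihilation j (creation j x) = x - creation j (annihilation j x) := by
  refine (CliffordAlgebra.contractLeft_ι_mul _ _ _).trans ?_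
  simp [creation, annihilation]

theorem basis_induction {p : ExtAlg n → Prop} (h0 : p 0) (hadd : ∀ x y, p x → p y → p (x + y))
    (hsmul : ∀ (c : ℂ) x, p x → p (c • x)) (hb : ∀ S, p (extBasis n S)) (x : ExtAlg n) : p x := by
  induction (extBasis n).mem_span x using Submodule.span_induction with
  | mem x h => obtain ⟨S, rfl⟩ := h; exact hb S
  | zero => exact h0
  | add x y _ _ hx hy => exact hadd x y hx hy
  | smul c x _ hx => exact hsmul c x hx

theorem extInner_zero_left (y : ExtAlg n) : extInner 0 y = 0 := by simp [extInner]

theorem extInner_zero_right (x : ExtAlg n) : extInner x 0 = 0 := by simp [extInner]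

/-- Creation and annihilation operators are adjoint to each other. -/
theorem extInner_creation_left (j : Fin n) (x y : ExtAlg n) :
    extInner (creation j x) y = extInner x (annihilation j y) := by
  induction x using basis_induction with
  | h0 => simp [extInner]
  | hadd a b ha hb => rw [map_add, extInner_add_left, extInner_add_left, ha, hb]
  | hsmul c a ha => rw [map_smul, extInner_smul_left, extInner_smul_left, ha]
  | hb S =>
    induction y using basis_induction with
    | h0 => simp [extInner]
    | hadd a b ha hb => rw [map_add, extInner_add_right, extInner_add_right, ha, hb]
    | hsmul c a ha => rw [map_smul, extInner_smul_right, extInner_smul_right, ha]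
    | hb T =>
      have key : ∀ U : Finset (Fin n), j ∉ U → ∃ s : ℝ, s * s = 1 ∧
          creation j (extBasis n U) = (s : ℂ) • extBasis n (insert j U) ∧
          annihilation j (extBasis n (insert j U)) = (s : ℂ) • extBasis n U := by
        intro U hU
        obtain ⟨s, hs, h⟩ := creation_basis_of_notMem j U hU
        have hs' : (s : ℂ) * s = 1 := by exact_mod_cast hs
        refine ⟨s, hs, h, ?_⟩
        have h2 : extBasis n (insert j U) = (s : ℂ) • creation j (extBasis n U) := by
          rw [h, smul_smul, hs', one_smul]
        rw [h2, map_smul, annihilation_creation, annihilation_basis_of_notMem j U hU, map_zero,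
          sub_zero]
      by_cases hT : j ∈ T
      · obtain ⟨s, -, h, h'⟩ := key (T.erase j) (Finset.notMem_erase j T)
        rw [Finset.insert_erase hT] at h h'
        rw [h', extInner_smul_right, extInner_basis]
        by_cases hST : S = T.erase j
        · rw [if_pos hST, hST, h, extInner_smul_left, extInner_basis, if_pos rfl]
          simp
        · rw [if_neg hST, mul_zero]
          by_cases hS : j ∈ S
          · rw [creation_basis_of_mem j S hS, extInner_zero_left]
          · obtain ⟨s', -, h', -⟩ := key S hS
            rw [h', extInner_smul_left, extInner_basis, if_neg, mul_zero]
            rintro rfl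
            exact hST (Finset.erase_insert hS).symm
      · rw [annihilation_basis_of_notMem j T hT, extInner_zero_right]
        by_cases hS : j ∈ S
        · rw [creation_basis_of_mem j S hS, extInner_zero_left]
        · obtain ⟨s', hs', h', -⟩ := key S hS
          rw [h', extInner_smul_left, extInner_basis, if_neg, mul_zero]
          rintro rfl
          exact hT (Finset.mem_insert_self j S)

theorem extInner_creation_right (j : Fin n) (x y : ExtAlg n) :
    extInner x (creation j y) = extInner (annihilation j x) y := by
  rw [← extInner_star, extInner_creation_left, extInner_star]

end Inner

/-! ### The natural representation of `SU(n)` -/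

section SU

variable {n : ℕ}

/-- Wedging with `v` is adjoint to contraction with `⟨v, ·⟩`. -/
theorem extInner_ι_mul_left (v : Fin n → ℂ) (x y : ExtAlg n) :
    extInner (ExteriorAlgebra.ι ℂ v * x) y =
      extInner x (CliffordAlgebra.contractLeft (Q := (0 : QuadraticForm ℂ (Fin n → ℂ)))
        (Fintype.linearCombination ℂ (star v)) y) := by
  have hv : v = ∑ j, v j • (Pi.single j 1 : Fin n → ℂ) := by
    simpa using (pi_eq_sum_univ' v)
  have hd : (Fintype.linearCombination ℂ (star v) : (Fin n → ℂ) →ₗ[ℂ] ℂ) =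
      ∑ j, star (v j) • (LinearMap.proj j : (Fin n → ℂ) →ₗ[ℂ] ℂ) := by
    ext j
    simp [Fintype.linearCombination_apply, Pi.single_apply]
  have h1 : ExteriorAlgebra.ι ℂ v * x = ∑ j, v j • creation j x := by
    conv_lhs => rw [hv]
    simp [Finset.sum_mul, creation]
  have h2 : CliffordAlgebra.contractLeft (Q := (0 : QuadraticForm ℂ (Fin n → ℂ)))
      (Fintype.linearCombination ℂ (star v)) y = ∑ j, star (v j) • annihilation j y := by
    rw [hd, map_sum, LinearMap.sum_apply]
    refine Finset.sum_congr rfl fun j _ => ?_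
    rw [map_smul]
    rfl
  have hl : ∀ f : Fin n → ExtAlg n, extInner (∑ j, f j) y = ∑ j, extInner (f j) y := fun f =>
    map_sum (AddMonoidHom.mk' (fun z => extInner z y) fun a b => extInner_add_left a b y) f _
  have hr : ∀ f : Fin n → ExtAlg n, extInner x (∑ j, f j) = ∑ j, extInner x (f j) := fun f =>
    map_sum (AddMonoidHom.mk' (fun z => extInner x z) fun a b => extInner_add_right x a b) f _
  rw [h1, h2, hl, hr]
  refine Finset.sum_congr rfl fun j _ => ?_
  rw [extInner_smul_left, extInner_smul_right, extInner_creation_left]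

/-- Naturality of contraction. -/
theorem contractLeft_map (f : (Fin n → ℂ) →ₗ[ℂ] (Fin n → ℂ)) (d : Module.Dual ℂ (Fin n → ℂ))
    (x : ExtAlg n) :
    CliffordAlgebra.contractLeft (Q := (0 : QuadraticForm ℂ (Fin n → ℂ))) d
        (ExteriorAlgebra.map f x) =
      ExteriorAlgebra.map f
        (CliffordAlgebra.contractLeft (Q := (0 : QuadraticForm ℂ (Fin n → ℂ))) (d ∘ₗ f) x) := by
  induction x using CliffordAlgebra.left_induction with
  | algebraMap r =>
    rw [AlgHom.commutes]
    refine (CliffordAlgebra.contractLeft_algebraMap _ d r).trans ?_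
    rw [CliffordAlgebra.contractLeft_algebraMap]
    exact (map_zero (ExteriorAlgebra.map f)).symm
  | add a b ha hb => simp only [map_add, ha, hb]
  | ι_mul a v ha =>
    have h : ExteriorAlgebra.map f (CliffordAlgebra.ι 0 v * a) =
        CliffordAlgebra.ι 0 (f v) * ExteriorAlgebra.map f a :=
      (map_mul _ _ _).trans (congrArg (· * _) (ExteriorAlgebra.map_apply_ι f v))
    rw [h]
    refine (CliffordAlgebra.contractLeft_ι_mul _ _ _).trans ?_
    rw [CliffordAlgebra.contractLeft_ι_mul, ha, map_sub, map_smul, map_mul]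
    congr 2
    exact (ExteriorAlgebra.map_apply_ι f v).symm

theorem extInner_one_left (y : ExtAlg n) : extInner 1 y = ExteriorAlgebra.algebraMapInv y := by
  induction y using CliffordAlgebra.left_induction with
  | algebraMap r =>
    have : (algebraMap ℂ (ExtAlg n) r) = r • extBasis n ∅ := by
      rw [extBasis_empty, Algebra.algebraMap_eq_smul_one]
    refine Eq.trans ?_ (AlgHom.commutes _ _).symm
    change extInner 1 (algebraMap ℂ (ExtAlg n) r) = r
    rw [this, ← extBasis_empty, extInner_smul_right, extInner_basis]
    simp
  | add a b ha hb => rw [extInner_add_right, map_add, ha, hb]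
  | ι_mul a v ha =>
    rw [← extInner_star]
    have h1 := extInner_ι_mul_left v a 1
    have h2 : CliffordAlgebra.contractLeft (Q := (0 : QuadraticForm ℂ (Fin n → ℂ)))
        (Fintype.linearCombination ℂ (star v)) 1 = 0 := CliffordAlgebra.contractLeft_one _ _
    refine (congrArg star (h1.trans (congrArg (extInner a) h2))).trans ?_
    rw [extInner_zero_right, star_zero, map_mul]
    have : ExteriorAlgebra.algebraMapInv (ExteriorAlgebra.ι ℂ v) = 0 := by
      simp [ExteriorAlgebra.algebraMapInv]
    exact (mul_eq_zero_of_left this _).symm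

/-- Unitary operators on `ℂⁿ` act on `Λ ℂⁿ` by unitary operators. -/
theorem extInner_map (g : Matrix (Fin n) (Fin n) ℂ) (hg : g ∈ Matrix.unitaryGroup (Fin n) ℂ)
    (x y : ExtAlg n) :
    extInner (ExteriorAlgebra.map (Matrix.toLin' g) x) (ExteriorAlgebra.map (Matrix.toLin' g) y) =
      extInner x y := by
  have hone : ∀ z : ExtAlg n,
      extInner 1 (ExteriorAlgebra.map (Matrix.toLin' g) z) = extInner 1 z := by
    intro z
    rw [extInner_one_left, extInner_one_left]
    have : (ExteriorAlgebra.algebraMapInv : ExtAlg n →ₐ[ℂ] ℂ).comp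
        (ExteriorAlgebra.map (Matrix.toLin' g)) = ExteriorAlgebra.algebraMapInv := by
      apply ExteriorAlgebra.hom_ext
      ext
      simp [ExteriorAlgebra.algebraMapInv]
    exact DFunLike.congr_fun this z
  induction x using CliffordAlgebra.left_induction generalizing y with
  | algebraMap r =>
    have h : algebraMap ℂ (CliffordAlgebra (0 : QuadraticForm ℂ (Fin n → ℂ))) r =
      (r • 1 : ExtAlg n) := Algebra.algebraMap_eq_smul_one r
    rw [h, map_smul, extInner_smul_left, extInner_smul_left, map_one, hone]
  | add a b ha hb => rw [map_add, extInner_add_left, extInner_add_left, ha, hb]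
  | ι_mul a v ha =>
    have h : ExteriorAlgebra.map (Matrix.toLin' g) (CliffordAlgebra.ι 0 v * a) =
        ExteriorAlgebra.ι ℂ (Matrix.toLin' g v) * ExteriorAlgebra.map (Matrix.toLin' g) a :=
      (map_mul _ _ _).trans (congrArg (· * _) (ExteriorAlgebra.map_apply_ι _ v))
    have hd : (Fintype.linearCombination ℂ (star (Matrix.toLin' g v))) ∘ₗ (Matrix.toLin' g) =
        Fintype.linearCombination ℂ (star v) := by
      ext w
      have h1 : ∀ u z : Fin n → ℂ, Fintype.linearCombination ℂ (star u) z = star u ⬝ᵥ z := by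
        intro u z
        simp [Fintype.linearCombination_apply, dotProduct, mul_comm]
      rw [LinearMap.comp_apply, LinearMap.comp_apply, LinearMap.comp_apply, h1, h1,
        Matrix.toLin'_apply, Matrix.toLin'_apply, Matrix.star_mulVec, Matrix.dotProduct_mulVec,
        Matrix.vecMul_vecMul, ← Matrix.star_eq_conjTranspose, hg.1, Matrix.vecMul_one]
    rw [h, extInner_ι_mul_left, contractLeft_map, hd, ha]
    exact (extInner_ι_mul_left v a y).symm

/-- The operator representation underlying `natRep`. -/
noncomputable def natRepEnd (n : ℕ) :
    Matrix.specialUnitaryGroup (Fin n) ℂ →* Module.End ℂ (ExtAlg n) where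
  toFun g := (ExteriorAlgebra.map (Matrix.toLin' (g : Matrix (Fin n) (Fin n) ℂ))).toLinearMap
  map_one' := by
    simp [Module.End.one_eq_id]
  map_mul' g h := by
    simp only [Submonoid.coe_mul, Matrix.toLin'_mul, ← ExteriorAlgebra.map_comp_map]
    rfl

/-- The natural representation `ρ : SU(n) → U(Λ ℂⁿ)`: the group element `g` acts by the algebra
automorphism of `Λ ℂⁿ` (it respects wedge products) extending the action of `g` on `ℂⁿ`. -/
noncomputable def natRep (n : ℕ) : Matrix.specialUnitaryGroup (Fin n) ℂ →* ExtUnitary n :=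
  (natRepEnd n).toHomUnits.codRestrict (ExtUnitary n) fun g x y => extInner_map _ g.2.1 x y

end SU

/-! ### The Clifford algebra, the spin group and the Dirac spinor representation -/

/-- The negative definite quadratic form `v ↦ -⟨v, v⟩` on `ℝᵐ`. In its Clifford algebra,
`v w + w v = -2 ⟨v, w⟩`. -/
noncomputable def negForm (m : ℕ) : QuadraticForm ℝ (Fin m → ℝ) :=
  QuadraticMap.weightedSumSquares ℝ fun _ : Fin m => (-1 : ℝ)

/-- The Clifford algebra `Cliff_m`. -/
abbrev Cliff (m : ℕ) : Type := CliffordAlgebra (negForm m)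

/-- The group `Spin(m)`, inside `Cliff_m`. -/
noncomputable abbrev Spin (m : ℕ) : Submonoid (Cliff m) := spinGroup (negForm m)

/-- The operators `φ_j = i (a_j + a_j^*)` and `π_j = a_j - a_j^*` on `Λ ℂⁿ`. -/
noncomputable def diracOp {n : ℕ} : Fin n ⊕ Fin n → Module.End ℂ (ExtAlg n)
  | Sum.inl j => Complex.I • (annihilation j + creation j)
  | Sum.inr j => annihilation j - creation j

section Dirac

variable {n : ℕ}

/-- The real-linear map `ℝ²ⁿ → End (Λ ℂⁿ)` sending the `k`-th standard basis vector to the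
operator `diracOp (σ k)`. -/
noncomputable def diracVec (σ : Fin (2 * n) ≃ Fin n ⊕ Fin n) :
    (Fin (2 * n) → ℝ) →ₗ[ℝ] Module.End ℂ (ExtAlg n) :=
  Fintype.linearCombination ℝ fun k => diracOp (σ k)

theorem diracVec_mul_self (σ : Fin (2 * n) ≃ Fin n ⊕ Fin n) (v : Fin (2 * n) → ℝ) :
    diracVec σ v * diracVec σ v = algebraMap ℝ _ (negForm (2 * n) v) := by
  set p : Fin n → ℝ := fun j => v (σ.symm (Sum.inl j)) with hp
  set q : Fin n → ℝ := fun j => v (σ.symm (Sum.inr j)) with hq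
  set d : Module.Dual ℂ (Fin n → ℂ) :=
    ∑ j, (Complex.I * p j + q j) • (LinearMap.proj j : (Fin n → ℂ) →ₗ[ℂ] ℂ) with hd
  set u : Fin n → ℂ := ∑ j, (Complex.I * p j - q j) • (Pi.single j 1 : Fin n → ℂ) with hu
  have hsum : ∀ x, diracVec σ v x =
      CliffordAlgebra.contractLeft (Q := (0 : QuadraticForm ℂ (Fin n → ℂ))) d x +
        ExteriorAlgebra.ι ℂ u * x := by
    intro x
    have h1 : CliffordAlgebra.contractLeft (Q := (0 : QuadraticForm ℂ (Fin n → ℂ))) d x =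
        ∑ j, (Complex.I * p j + q j) • annihilation j x := by
      rw [hd, map_sum, LinearMap.sum_apply]
      exact Finset.sum_congr rfl fun j _ => by rw [map_smul]; rfl
    have h2 : ExteriorAlgebra.ι ℂ u * x = ∑ j, (Complex.I * p j - q j) • creation j x := by
      rw [hu]
      simp [Finset.sum_mul, creation]
    have h3 : diracVec σ v = ∑ s, v (σ.symm s) • diracOp s := by
      rw [diracVec, Fintype.linearCombination_apply, ← σ.symm.sum_comp]
      simp
    rw [h3, h1, h2, Fintype.sum_sum_type, LinearMap.add_apply, LinearMap.sum_apply,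
      LinearMap.sum_apply, ← Finset.sum_add_distrib, ← Finset.sum_add_distrib]
    refine Finset.sum_congr rfl fun j _ => ?_
    simp only [diracOp, LinearMap.smul_apply, LinearMap.add_apply, LinearMap.sub_apply,
      ← Complex.coe_smul]
    module
  have hdu : d u = (negForm (2 * n) v : ℝ) := by
    have h4 : negForm (2 * n) v = ∑ s, -(v (σ.symm s) * v (σ.symm s)) := by
      rw [negForm, QuadraticMap.weightedSumSquares_apply, ← σ.symm.sum_comp]
      simp
    have h5 : ∀ j, u j = Complex.I * p j - q j := by
      intro j
      simp [hu, Finset.sum_apply, Pi.single_apply]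
    rw [h4, Fintype.sum_sum_type, ← Finset.sum_add_distrib, hd, LinearMap.sum_apply]
    push_cast
    refine Finset.sum_congr rfl fun j _ => ?_
    rw [LinearMap.smul_apply, LinearMap.proj_apply, h5, smul_eq_mul]
    linear_combination (p j : ℂ) * p j * Complex.I_mul_I
  refine LinearMap.ext fun x => ?_
  have h6 : CliffordAlgebra.contractLeft (Q := (0 : QuadraticForm ℂ (Fin n → ℂ))) d
      (CliffordAlgebra.contractLeft (Q := (0 : QuadraticForm ℂ (Fin n → ℂ))) d x) = 0 :=
    CliffordAlgebra.contractLeft_contractLeft d x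
  have h7 : CliffordAlgebra.contractLeft (Q := (0 : QuadraticForm ℂ (Fin n → ℂ))) d
      (ExteriorAlgebra.ι ℂ u * x) = d u • x - ExteriorAlgebra.ι ℂ u *
        CliffordAlgebra.contractLeft (Q := (0 : QuadraticForm ℂ (Fin n → ℂ))) d x :=
    CliffordAlgebra.contractLeft_ι_mul d u x
  have h8 : ExteriorAlgebra.ι ℂ u * (ExteriorAlgebra.ι ℂ u * x) = 0 := by
    rw [← mul_assoc, ExteriorAlgebra.ι_sq_zero, zero_mul]
  rw [Module.End.mul_apply, hsum, hsum, map_add, h6, h7, mul_add, h8, hdu,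
    Algebra.algebraMap_eq_smul_one, LinearMap.smul_apply, Module.End.one_apply, Complex.coe_smul]
  abel

/-- The `Cliff_{2n}`-module structure on `Λ ℂⁿ` sending the generators `γ_1, …, γ_{2n}` to the
operators `φ_1, …, φ_n, π_1, …, π_n`, in the order prescribed by `σ`. -/
noncomputable def cliffordAction (σ : Fin (2 * n) ≃ Fin n ⊕ Fin n) :
    Cliff (2 * n) →ₐ[ℝ] Module.End ℂ (ExtAlg n) :=
  CliffordAlgebra.lift (negForm (2 * n)) ⟨diracVec σ, diracVec_mul_self σ⟩

theorem extInner_diracOp (k : Fin n ⊕ Fin n) (x y : ExtAlg n) :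
    extInner (diracOp k x) y = -extInner x (diracOp k y) := by
  rcases k with j | j
  · simp only [diracOp, LinearMap.smul_apply, LinearMap.add_apply, extInner_smul_left,
      extInner_smul_right, extInner_add_left, extInner_add_right, extInner_creation_left,
      extInner_creation_right]
    rw [Complex.star_def, Complex.conj_I]
    ring
  · simp only [diracOp, sub_eq_add_neg, ← neg_one_smul ℂ (creation j), LinearMap.smul_apply,
      LinearMap.add_apply, extInner_smul_left,
      extInner_smul_right, extInner_add_left, extInner_add_right, extInner_creation_left,
      extInner_creation_right]
    simp

/-- The Clifford action turns the canonical involution of `Cliff_{2n}` into the adjoint. -/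
theorem extInner_cliffordAction (σ : Fin (2 * n) ≃ Fin n ⊕ Fin n) (c : Cliff (2 * n))
    (x y : ExtAlg n) :
    extInner (cliffordAction σ c x) y = extInner x (cliffordAction σ (star c) y) := by
  have hreal : ∀ (r : ℝ) (T : Module.End ℂ (ExtAlg n)) z, (r • T) z = (r : ℂ) • T z := fun r T z => by
    rw [LinearMap.smul_apply, Complex.coe_smul]
  induction c using CliffordAlgebra.induction generalizing x y with
  | algebraMap r =>
    rw [CliffordAlgebra.star_algebraMap, AlgHom.commutes, Algebra.algebraMap_eq_smul_one, hreal,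
      hreal, extInner_smul_left, extInner_smul_right]
    simp
  | ι v =>
    rw [CliffordAlgebra.star_ι, map_neg, cliffordAction, CliffordAlgebra.lift_ι_apply]
    simp only [diracVec, Fintype.linearCombination_apply]
    have hl : ∀ f : Fin (2 * n) → ExtAlg n, extInner (∑ j, f j) y = ∑ j, extInner (f j) y := fun f =>
      map_sum (AddMonoidHom.mk' (fun z => extInner z y) fun a b => extInner_add_left a b y) f _
    have hr : ∀ f : Fin (2 * n) → ExtAlg n, extInner x (∑ j, f j) = ∑ j, extInner x (f j) := fun f =>
      map_sum (AddMonoidHom.mk' (fun z => extInner x z) fun a b => extInner_add_right x a b) f _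
    rw [← neg_one_smul ℂ, LinearMap.smul_apply, extInner_smul_right, LinearMap.sum_apply,
      LinearMap.sum_apply, hl, hr, Finset.mul_sum]
    refine Finset.sum_congr rfl fun k _ => ?_
    rw [hreal, hreal, extInner_smul_left, extInner_smul_right, extInner_diracOp]
    simp
  | mul a b ha hb => rw [map_mul, Module.End.mul_apply, ha, hb, star_mul, map_mul, Module.End.mul_apply]
  | add a b ha hb =>
    rw [map_add, star_add, map_add, LinearMap.add_apply, LinearMap.add_apply, extInner_add_left,
      extInner_add_right, ha, hb]

/-- The Dirac spinor representation `ρ' : Spin(2n) → U(Λ ℂⁿ)`: the restriction to `Spin(2n)` of the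
action of `Cliff_{2n}`. -/
noncomputable def diracRep (σ : Fin (2 * n) ≃ Fin n ⊕ Fin n) : Spin (2 * n) →* ExtUnitary n :=
  (((cliffordAction σ : Cliff (2 * n) →* Module.End ℂ (ExtAlg n)).comp
    (Spin (2 * n)).subtype).toHomUnits).codRestrict (ExtUnitary n) fun s x y => by
      change extInner (cliffordAction σ s x) (cliffordAction σ s y) = extInner x y
      rw [extInner_cliffordAction, ← Module.End.mul_apply, ← map_mul,
        spinGroup.star_mul_self_of_mem s.2, map_one, Module.End.one_apply]

end Dirac

/-! ### Lie group homomorphisms -/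

/-- Smoothness of a map from a subset `A` of a normed space to a finite-dimensional real vector
space `F`: near every point of `A`, the map is the restriction of a smooth map on an open subset of
the ambient space. A map into `F` is smooth if all its coordinates are. If `A` is an embedded
submanifold, this is smoothness on the manifold `A`; if the map takes values in an embedded
submanifold of `F`, it is smoothness as a map into that submanifold. -/
def IsSmoothOnSubset {E F : Type*} [NormedAddCommGroup E] [NormedSpace ℝ E] [AddCommGroup F]
    [Module ℝ F] (A : Set E) (f : A → F) : Prop :=
  ∀ a : A, ∃ U : Set E, IsOpen U ∧ (a : E) ∈ U ∧ ∃ f' : E → F,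
    (∀ l : Module.Dual ℝ F, ContDiffOn ℝ ∞ (fun x => l (f' x)) U) ∧
    ∀ x : A, (x : E) ∈ U → f' x = f x

open scoped Matrix.Norms.Elementwise in
/-- A group homomorphism `SU(n) → Spin(m)` is a Lie group homomorphism if it is smooth. Here `SU(n)`
carries the smooth structure of a closed subgroup of the matrix group (an embedded submanifold of
the real vector space of complex matrices), and `Spin(m)` that of a closed subgroup of the group of
units of `Cliff_m` (an embedded submanifold of the real vector space `Cliff_m`). -/
def IsLieGroupHom {n m : ℕ} (ψ : Matrix.specialUnitaryGroup (Fin n) ℂ →* Spin m) : Prop :=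
  IsSmoothOnSubset (Matrix.specialUnitaryGroup (Fin n) ℂ : Set (Matrix (Fin n) (Fin n) ℂ))
    fun g => (ψ g : Cliff m)

end SpinorRep

namespace SpinorRep

/-! ### Faithfulness of the Clifford action -/

section Faithful

variable {n : ℕ}

/-! The Clifford action is faithful, so an element of `Spin (2 * n)` is determined by the operator
it induces. It therefore suffices to find, for each `g` in `SU(n)`, some spin element acting as
`extMap g`: uniqueness makes the choice multiplicative, and a linear left inverse of the action
makes it smooth.

Faithfulness (`cliffordAction_injective`) is a dimension count. The operators φ_j and π_j span the
creation and annihilation operators over ℂ, and these generate all of End(Λℂⁿ). So the complexified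
Clifford algebra, of dimension 2^(2n), maps onto an algebra of dimension (2^n)^2, hence injectively.

For existence, write a unitary matrix as a product of complex reflections, each multiplying a unit
vector u by μ² with |μ| = 1 and fixing its orthogonal complement. If a* is the wedge with u and a
its adjoint, the reflection acts on Λℂⁿ as 1 + (μ² - 1)a*a, which is μ times the action of a product
of two unit vectors in the real plane ℂu (`extMap_complexReflection`). Here μ is a square root of
the determinant, and both sides are multiplicative. So every unitary g acts as a square root of det
g times a spin element (`hasSpinLift_of_fixes`). For det g = 1 the root is ±1, and the sign is
absorbed because -1 is itself a spin element when n > 0. -/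

theorem exists_annihilation_basis_insert (j : Fin n) (S : Finset (Fin n)) (h : j ∉ S) :
    ∃ s : ℂ, s • annihilation j (extBasis n (insert j S)) = extBasis n S := by
  obtain ⟨s, hs, hc⟩ := creation_basis_of_notMem j S h
  refine ⟨s, ?_⟩
  rw [← map_smul, ← hc, annihilation_creation, annihilation_basis_of_notMem j S h, map_zero,
    sub_zero]

theorem exists_creation_basis (j : Fin n) (S : Finset (Fin n)) (h : j ∉ S) :
    ∃ s : ℂ, s • creation j (extBasis n S) = extBasis n (insert j S) := by
  obtain ⟨s, hs, hc⟩ := creation_basis_of_notMem j S h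
  refine ⟨s, ?_⟩
  have hs' : (s : ℂ) * s = 1 := by exact_mod_cast hs
  rw [hc, smul_smul, hs', one_smul]

variable {A : Subalgebra ℂ (Module.End ℂ (ExtAlg n))}

/-- Each basis vector is an eigenvector of the number operators: a_j* a_j selects the sets
containing j, and a_j a_j* those avoiding j. A product of one such factor for each j in `F` is the
required projection; for `F` the whole index set it has rank one. -/
theorem exists_mem_projection (hc : ∀ j, creation j ∈ A) (ha : ∀ j, annihilation j ∈ A)
    (T F : Finset (Fin n)) :
    ∃ P ∈ A, ∀ S, P (extBasis n S) =
      if ∀ j ∈ F, (j ∈ S ↔ j ∈ T) then extBasis n S else 0 := by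
  induction F using Finset.induction_on with
  | empty => exact ⟨1, one_mem A, fun S => by simp⟩
  | insert j F _ ih =>
    obtain ⟨P, hP, hPS⟩ := ih
    have hnum : ∀ S : Finset (Fin n), creation j (annihilation j (extBasis n S)) =
        if j ∈ S then extBasis n S else 0 := by
      intro S
      have h := annihilation_creation j (extBasis n S)
      split_ifs with hj
      · rw [creation_basis_of_mem j S hj, map_zero] at h
        exact (sub_eq_zero.1 h.symm).symm
      · rw [annihilation_basis_of_notMem j S hj, map_zero]
    have hnum' : ∀ S : Finset (Fin n), annihilation j (creation j (extBasis n S)) =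
        if j ∈ S then 0 else extBasis n S := by
      intro S
      rw [annihilation_creation, hnum]
      split_ifs <;> simp
    by_cases hT : j ∈ T
    · refine ⟨creation j * annihilation j * P, mul_mem (mul_mem (hc j) (ha j)) hP, fun S => ?_⟩
      simp only [Module.End.mul_apply, hPS, Finset.forall_mem_insert]
      by_cases hF : ∀ i ∈ F, (i ∈ S ↔ i ∈ T)
      · rw [if_pos hF, hnum]
        by_cases hS : j ∈ S
        · rw [if_pos hS, if_pos ⟨⟨fun _ => hT, fun _ => hS⟩, hF⟩]
        · rw [if_neg hS, if_neg (fun h => hS (h.1.2 hT))]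
      · rw [if_neg hF, if_neg (fun h => hF h.2), map_zero, map_zero]
    · refine ⟨annihilation j * creation j * P, mul_mem (mul_mem (ha j) (hc j)) hP, fun S => ?_⟩
      simp only [Module.End.mul_apply, hPS, Finset.forall_mem_insert]
      by_cases hF : ∀ i ∈ F, (i ∈ S ↔ i ∈ T)
      · rw [if_pos hF, hnum']
        by_cases hS : j ∈ S
        · rw [if_pos hS, if_neg (fun h => hT (h.1.1 hS))]
        · rw [if_neg hS, if_pos ⟨⟨fun h => (hS h).elim, fun h => (hT h).elim⟩, hF⟩]
      · rw [if_neg hF, if_neg (fun h => hF h.2), map_zero, map_zero]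

/-- Up to sign, annihilators lower any basis vector to the vacuum 1, and creators raise the vacuum
to any other. -/
theorem exists_mem_map_basis (hc : ∀ j, creation j ∈ A) (ha : ∀ j, annihilation j ∈ A)
    (S T : Finset (Fin n)) : ∃ B ∈ A, B (extBasis n T) = extBasis n S := by
  have down : ∀ T : Finset (Fin n), ∃ B ∈ A, B (extBasis n T) = extBasis n ∅ := by
    intro T
    induction T using Finset.induction_on with
    | empty => exact ⟨1, one_mem A, rfl⟩
    | insert j T hj ih =>
      obtain ⟨B, hB, h⟩ := ih
      obtain ⟨s, hs⟩ := exists_annihilation_basis_insert j T hj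
      exact ⟨B * s • annihilation j, mul_mem hB (A.smul_mem (ha j) s), by
        rw [Module.End.mul_apply, LinearMap.smul_apply, hs, h]⟩
  have up : ∀ S : Finset (Fin n), ∃ B ∈ A, B (extBasis n ∅) = extBasis n S := by
    intro S
    induction S using Finset.induction_on with
    | empty => exact ⟨1, one_mem A, rfl⟩
    | insert j S hj ih =>
      obtain ⟨B, hB, h⟩ := ih
      obtain ⟨s, hs⟩ := exists_creation_basis j S hj
      exact ⟨s • creation j * B, mul_mem (A.smul_mem (hc j) s) hB, by
        rw [Module.End.mul_apply, LinearMap.smul_apply, h, hs]⟩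
  obtain ⟨B, hB, h⟩ := down T
  obtain ⟨B', hB', h'⟩ := up S
  exact ⟨B' * B, mul_mem hB' hB, by rw [Module.End.mul_apply, h, h']⟩

/-- A sum of rank one operators recovering a given operator from its values on the basis. -/
theorem end_eq_sum_smulRight (f : Module.End ℂ (ExtAlg n)) :
    f = ∑ T, ((extBasis n).coord T).smulRight (f (extBasis n T)) := by
  refine (extBasis n).ext fun S => ?_
  simp [LinearMap.sum_apply, Finsupp.single_apply, ite_smul]

/-- The creation and annihilation operators generate the algebra of all operators. -/
theorem eq_top_of_creation_annihilation_mem (hc : ∀ j, creation j ∈ A)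
    (ha : ∀ j, annihilation j ∈ A) : A = ⊤ := by
  refine eq_top_iff.2 fun f _ => ?_
  rw [end_eq_sum_smulRight f]
  refine sum_mem fun T _ => ?_
  obtain ⟨P, hP, hPS⟩ := exists_mem_projection hc ha T Finset.univ
  have hPS' : ∀ S, P (extBasis n S) = if S = T then extBasis n S else 0 := by
    intro S
    rw [hPS]
    simp [Finset.ext_iff]
  choose B hB hBS using fun S => exists_mem_map_basis hc ha S T
  -- `B S * P` is the matrix unit that sends basis vector `T` to basis vector `S` and kills all
  -- others.
  have : ((extBasis n).coord T).smulRight (f (extBasis n T)) =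
      ∑ S, (extBasis n).repr (f (extBasis n T)) S • (B S * P) := by
    refine (extBasis n).ext fun U => ?_
    simp only [LinearMap.smulRight_apply, Module.Basis.coord_apply, Module.Basis.repr_self,
      LinearMap.sum_apply, LinearMap.smul_apply, Module.End.mul_apply, hPS']
    by_cases hU : U = T
    · subst hU
      simp [hBS, Module.Basis.sum_repr]
    · simp [hU]
  rw [this]
  exact sum_mem fun S _ => A.smul_mem (mul_mem (hB S) hP) _

/-! ### The complexified Clifford action and its bijectivity -/

theorem cliffordAction_ι (σ : Fin (2 * n) ≃ Fin n ⊕ Fin n) (v : Fin (2 * n) → ℝ) :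
    cliffordAction σ (CliffordAlgebra.ι _ v) = diracVec σ v :=
  CliffordAlgebra.lift_ι_apply _ _ _

theorem diracVec_single (σ : Fin (2 * n) ≃ Fin n ⊕ Fin n) (k : Fin n ⊕ Fin n) :
    diracVec σ (Pi.single (σ.symm k) 1) = diracOp k := by
  simp [diracVec, Fintype.linearCombination_apply, Pi.single_apply]

/-- The complexification of the Clifford action. -/
noncomputable def complexCliffordAction (σ : Fin (2 * n) ≃ Fin n ⊕ Fin n) :
    TensorProduct ℝ ℂ (Cliff (2 * n)) →ₐ[ℂ] Module.End ℂ (ExtAlg n) :=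
  AlgHom.liftEquiv ℝ ℂ (Cliff (2 * n)) (Module.End ℂ (ExtAlg n)) (cliffordAction σ)

theorem complexCliffordAction_surjective (σ : Fin (2 * n) ≃ Fin n ⊕ Fin n) :
    Function.Surjective (complexCliffordAction σ) := by
  rw [← AlgHom.range_eq_top]
  have hmem : ∀ k, diracOp k ∈ (complexCliffordAction σ).range := by
    intro k
    refine ⟨1 ⊗ₜ CliffordAlgebra.ι _ (Pi.single (σ.symm k) 1), ?_⟩
    change (1 : ℂ) • cliffordAction σ _ = _
    rw [one_smul, cliffordAction_ι, diracVec_single]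
  -- Solve φ_j = i(a_j + a_j*), π_j = a_j - a_j* for a_j and a_j*. This needs complex coefficients,
  -- hence the complexification.
  have ha : ∀ j : Fin n, annihilation j =
      (2⁻¹ : ℂ) • (-Complex.I • diracOp (Sum.inl j) + diracOp (Sum.inr j)) := by
    intro j
    simp only [diracOp, smul_smul, neg_mul, Complex.I_mul_I]
    module
  have hc : ∀ j : Fin n, creation j =
      (2⁻¹ : ℂ) • (-Complex.I • diracOp (Sum.inl j) - diracOp (Sum.inr j)) := by
    intro j
    simp only [diracOp, smul_smul, neg_mul, Complex.I_mul_I]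
    module
  refine eq_top_of_creation_annihilation_mem (fun j => ?_) fun j => ?_
  · rw [hc]
    exact Subalgebra.smul_mem _ (sub_mem (Subalgebra.smul_mem _ (hmem _) _) (hmem _)) _
  · rw [ha]
    exact Subalgebra.smul_mem _ (add_mem (Subalgebra.smul_mem _ (hmem _) _) (hmem _)) _

/-- The basis of the Clifford algebra corresponding to that of the exterior algebra. -/
noncomputable def cliffBasis (m : ℕ) : Module.Basis (Finset (Fin m)) ℝ (Cliff m) :=
  ((Pi.basisFun ℝ (Fin m)).ExteriorAlgebra).map (CliffordAlgebra.equivExterior (negForm m)).symm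

theorem cliffordAction_injective (σ : Fin (2 * n) ≃ Fin n ⊕ Fin n) :
    Function.Injective (cliffordAction σ) := by
  have := Module.Finite.of_basis (extBasis n)
  have := Module.Free.of_basis (extBasis n)
  have := Module.Finite.of_basis (cliffBasis (2 * n))
  have hrank : Module.finrank ℂ (TensorProduct ℝ ℂ (Cliff (2 * n))) =
      Module.finrank ℂ (Module.End ℂ (ExtAlg n)) := by
    rw [Module.finrank_baseChange, Module.finrank_linearMap,
      Module.finrank_eq_card_basis (extBasis n),
      Module.finrank_eq_card_basis (cliffBasis (2 * n))]
    simp only [Fintype.card_finset, Fintype.card_fin]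
    rw [← pow_add, two_mul]
  have hinj : Function.Injective (complexCliffordAction σ).toLinearMap :=
    (LinearMap.injective_iff_surjective_of_finrank_eq_finrank hrank).2
      (complexCliffordAction_surjective σ)
  have hincl : Function.Injective
      (Algebra.TensorProduct.includeRight : Cliff (2 * n) →ₐ[ℝ] TensorProduct ℝ ℂ (Cliff (2 * n))) :=
    Algebra.TensorProduct.includeRight_injective (algebraMap ℝ ℂ).injective
  intro x y hxy
  refine hincl (hinj ?_)
  change (1 : ℂ) • cliffordAction σ x = (1 : ℂ) • cliffordAction σ y
  rw [hxy]

end Faithful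

/-! ### Complex reflections and their spin lifts -/

section Reflection

variable {n : ℕ}

/-- The identification of `ℂⁿ` with `ℝ²ⁿ` by real and imaginary parts, in the order of `σ`. -/
def realVec (σ : Fin (2 * n) ≃ Fin n ⊕ Fin n) (u : Fin n → ℂ) : Fin (2 * n) → ℝ :=
  fun k => Sum.elim (fun j => (u j).re) (fun j => (u j).im) (σ k)

/-- Contraction with `⟨u, ·⟩`. -/
noncomputable def contraction (u : Fin n → ℂ) : Module.End ℂ (ExtAlg n) :=
  CliffordAlgebra.contractLeft (Q := (0 : QuadraticForm ℂ (Fin n → ℂ)))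
    (Fintype.linearCombination ℂ (star u))

theorem contraction_apply (u : Fin n → ℂ) (x : ExtAlg n) :
    contraction u x = ∑ j, star (u j) • annihilation j x := by
  have hd : (Fintype.linearCombination ℂ (star u) : (Fin n → ℂ) →ₗ[ℂ] ℂ) =
      ∑ j, star (u j) • (LinearMap.proj j : (Fin n → ℂ) →ₗ[ℂ] ℂ) := by
    ext j
    simp [Fintype.linearCombination_apply, Pi.single_apply]
  rw [contraction, hd, map_sum, LinearMap.sum_apply]
  refine Finset.sum_congr rfl fun j _ => ?_
  rw [map_smul]
  rfl

theorem ι_mul_eq_sum_creation (u : Fin n → ℂ) (x : ExtAlg n) :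
    ExteriorAlgebra.ι ℂ u * x = ∑ j, u j • creation j x := by
  have hv : u = ∑ j, u j • (Pi.single j 1 : Fin n → ℂ) := by
    simpa using (pi_eq_sum_univ' u)
  conv_lhs => rw [hv]
  simp [Finset.sum_mul, creation]

theorem contraction_smul (c : ℂ) (u : Fin n → ℂ) (x : ExtAlg n) :
    contraction (c • u) x = star c • contraction u x := by
  simp [contraction_apply, Finset.smul_sum, smul_smul]

theorem contraction_contraction (u : Fin n → ℂ) (x : ExtAlg n) :
    contraction u (contraction u x) = 0 :=
  CliffordAlgebra.contractLeft_contractLeft _ x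

theorem contraction_ι_mul (u v : Fin n → ℂ) (x : ExtAlg n) :
    contraction u (ExteriorAlgebra.ι ℂ v * x) =
      (star u ⬝ᵥ v) • x - ExteriorAlgebra.ι ℂ v * contraction u x := by
  have h : star u ⬝ᵥ v = Fintype.linearCombination ℂ (star u) v := by
    simp [Fintype.linearCombination_apply, dotProduct, mul_comm]
  rw [h]
  exact CliffordAlgebra.contractLeft_ι_mul _ v x

/-- Pairing Re u with the φ_j and Im u with the π_j makes conj(u_j) the coefficient of a_j and u_j
that of a_j*, up to the common factor i. -/
theorem diracVec_realVec (σ : Fin (2 * n) ≃ Fin n ⊕ Fin n) (u : Fin n → ℂ) (x : ExtAlg n) :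
    diracVec σ (realVec σ u) x = Complex.I • (contraction u x + ExteriorAlgebra.ι ℂ u * x) := by
  rw [contraction_apply, ι_mul_eq_sum_creation, ← Finset.sum_add_distrib, diracVec,
    Fintype.linearCombination_apply, ← σ.symm.sum_comp, Fintype.sum_sum_type,
    ← Finset.sum_add_distrib, LinearMap.sum_apply, Finset.smul_sum]
  refine Finset.sum_congr rfl fun j _ => ?_
  simp only [realVec, Equiv.apply_symm_apply, Sum.elim_inl, Sum.elim_inr, diracOp,
    LinearMap.smul_apply, LinearMap.add_apply, LinearMap.sub_apply, ← Complex.coe_smul]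
  have h1 : star (u j) = (u j).re - (u j).im * Complex.I := by
    apply Complex.ext <;> simp
  have h2 : u j = (u j).re + (u j).im * Complex.I := (Complex.re_add_im _).symm
  rw [h1]
  conv_rhs => rw [h2]
  simp only [Complex.add_re, Complex.add_im, Complex.ofReal_re, Complex.ofReal_im, Complex.mul_re,
    Complex.mul_im, Complex.I_re, Complex.I_im]
  match_scalars
  · linear_combination ((u j).im : ℂ) * Complex.I_mul_I
  · linear_combination (-(u j).im : ℂ) * Complex.I_mul_I

theorem negForm_realVec (σ : Fin (2 * n) ≃ Fin n ⊕ Fin n) {u : Fin n → ℂ}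
    (hu : star u ⬝ᵥ u = 1) : negForm (2 * n) (realVec σ u) = -1 := by
  refine Eq.trans ?_ (congrArg (fun z : ℂ => -z.re) hu)
  rw [negForm, QuadraticMap.weightedSumSquares_apply, ← σ.symm.sum_comp, Fintype.sum_sum_type,
    ← Finset.sum_add_distrib, dotProduct, Complex.re_sum, ← Finset.sum_neg_distrib]
  refine Finset.sum_congr rfl fun j _ => ?_
  simp [realVec]
  ring

/-! ### Unit vectors and their products in the pin and spin groups -/

theorem ι_mem_pinGroup {m : ℕ} {v : Fin m → ℝ} (hv : negForm m v = -1) :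
    CliffordAlgebra.ι (negForm m) v ∈ pinGroup (negForm m) := by
  have hsq : CliffordAlgebra.ι (negForm m) v * CliffordAlgebra.ι (negForm m) v = -1 := by
    rw [CliffordAlgebra.ι_sq_scalar, hv, map_neg, map_one]
  -- Since v² = -1, the element -v is both the inverse and the star of v.
  refine ⟨⟨⟨_, -CliffordAlgebra.ι (negForm m) v, by rw [mul_neg, hsq, neg_neg],
    by rw [neg_mul, hsq, neg_neg]⟩, Subgroup.subset_closure ⟨v, rfl⟩, rfl⟩, ?_⟩
  rw [SetLike.mem_coe, Unitary.mem_iff, CliffordAlgebra.star_ι]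
  exact ⟨by rw [neg_mul, hsq, neg_neg], by rw [mul_neg, hsq, neg_neg]⟩

theorem ι_mul_ι_mem_spin {m : ℕ} {v w : Fin m → ℝ} (hv : negForm m v = -1)
    (hw : negForm m w = -1) :
    CliffordAlgebra.ι (negForm m) v * CliffordAlgebra.ι (negForm m) w ∈ Spin m :=
  ⟨mul_mem (ι_mem_pinGroup hv) (ι_mem_pinGroup hw),
    CliffordAlgebra.ι_mul_ι_mem_evenOdd_zero _ v w⟩

theorem neg_one_mem_spin {m : ℕ} {v : Fin m → ℝ} (hv : negForm m v = -1) :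
    (-1 : Cliff m) ∈ Spin m := by
  have h := ι_mul_ι_mem_spin hv hv
  rwa [CliffordAlgebra.ι_sq_scalar, hv, map_neg, map_one] at h

/-! ### Operators on the exterior algebra induced by matrices -/

/-- The operator on `Λ ℂⁿ` induced by a matrix. -/
noncomputable def extMap (g : Matrix (Fin n) (Fin n) ℂ) : Module.End ℂ (ExtAlg n) :=
  (ExteriorAlgebra.map (Matrix.toLin' g)).toLinearMap

theorem extMap_one : extMap (1 : Matrix (Fin n) (Fin n) ℂ) = 1 := by
  simp [extMap, Module.End.one_eq_id]

theorem extMap_mul (g h : Matrix (Fin n) (Fin n) ℂ) : extMap (g * h) = extMap g * extMap h := by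
  simp only [extMap, Matrix.toLin'_mul, ← ExteriorAlgebra.map_comp_map]
  rfl

theorem extMap_ι_mul (g : Matrix (Fin n) (Fin n) ℂ) (v : Fin n → ℂ) (x : ExtAlg n) :
    extMap g (ExteriorAlgebra.ι ℂ v * x) = ExteriorAlgebra.ι ℂ (g.mulVec v) * extMap g x :=
  (map_mul (ExteriorAlgebra.map (Matrix.toLin' g)) _ _).trans
    (congrArg (· * _) (ExteriorAlgebra.map_apply_ι _ v))

theorem extMap_algebraMap (g : Matrix (Fin n) (Fin n) ℂ) (r : ℂ) :
    extMap g (algebraMap ℂ (ExtAlg n) r) = algebraMap ℂ (ExtAlg n) r :=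
  AlgHom.commutes _ r

/-- The action on `Λ ℂⁿ` of a rank one perturbation of the identity. -/
theorem extMap_one_add_vecMulVec (c : ℂ) (u : Fin n → ℂ) (x : ExtAlg n) :
    extMap (1 + c • Matrix.vecMulVec u (star u)) x =
      x + c • (ExteriorAlgebra.ι ℂ u * contraction u x) := by
  induction x using CliffordAlgebra.left_induction with
  | algebraMap r =>
    have h : contraction u (algebraMap ℂ (ExtAlg n) r) = 0 :=
      CliffordAlgebra.contractLeft_algebraMap _ _ r
    refine (extMap_algebraMap _ r).trans (Eq.symm ?_)
    refine (congrArg (fun z => algebraMap ℂ (ExtAlg n) r + c • (ExteriorAlgebra.ι ℂ u * z)) h).trans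
      ?_
    simp
  | add a b ha hb =>
    rw [map_add, map_add, ha, hb, mul_add, smul_add]
    abel
  | ι_mul a v ha =>
    refine (extMap_ι_mul _ v a).trans (Eq.trans ?_ (congrArg (fun z => ExteriorAlgebra.ι ℂ v * a +
      c • (ExteriorAlgebra.ι ℂ u * z)) (contraction_ι_mul u v a)).symm)
    have hv : (1 + c • Matrix.vecMulVec u (star u)).mulVec v = v + (c * (star u ⬝ᵥ v)) • u := by
      rw [Matrix.add_mulVec, Matrix.one_mulVec, Matrix.smul_mulVec, Matrix.vecMulVec_mulVec,
        op_smul_eq_smul, smul_smul]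
    -- In the product of v + c⟨u,v⟩u with a + c u∧(contraction of a), the term containing u twice
    -- vanishes. Moving u past v gives the sign with which contraction passes v.
    have hanti : ExteriorAlgebra.ι ℂ u * (ExteriorAlgebra.ι ℂ v * contraction u a) =
        -(ExteriorAlgebra.ι ℂ v * (ExteriorAlgebra.ι ℂ u * contraction u a)) := by
      rw [← mul_assoc, ← mul_assoc, ← neg_mul]
      congr 1
      exact eq_neg_of_add_eq_zero_left (ExteriorAlgebra.ι_add_mul_swap u v)
    have hsq : ExteriorAlgebra.ι ℂ u * (ExteriorAlgebra.ι ℂ u * contraction u a) = 0 := by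
      rw [← mul_assoc, ExteriorAlgebra.ι_sq_zero, zero_mul]
    rw [hv, ha, mul_sub, hanti, map_add, map_smul, add_mul, mul_add, mul_add, smul_mul_assoc,
      smul_mul_assoc, mul_smul_comm, mul_smul_comm, mul_smul_comm, hsq]
    module

/-- The complex reflection multiplying the unit vector `u` by `μ ^ 2`. -/
def complexReflection (u : Fin n → ℂ) (μ : ℂ) : Matrix (Fin n) (Fin n) ℂ :=
  1 + (μ ^ 2 - 1) • Matrix.vecMulVec u (star u)

theorem complexReflection_mulVec (u : Fin n → ℂ) (μ : ℂ) (v : Fin n → ℂ) :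
    (complexReflection u μ).mulVec v = v + ((μ ^ 2 - 1) * (star u ⬝ᵥ v)) • u := by
  rw [complexReflection, Matrix.add_mulVec, Matrix.one_mulVec, Matrix.smul_mulVec,
    Matrix.vecMulVec_mulVec, op_smul_eq_smul, smul_smul]

variable {u : Fin n → ℂ} {μ : ℂ}

theorem complexReflection_mul_star (hu : star u ⬝ᵥ u = 1) (hμ : μ * star μ = 1) :
    complexReflection u μ * complexReflection u (star μ) = 1 := by
  have hP : Matrix.vecMulVec u (star u) * Matrix.vecMulVec u (star u) =
      Matrix.vecMulVec u (star u) := by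
    rw [Matrix.vecMulVec_mul_vecMulVec, hu]
    simp
  simp only [complexReflection, mul_add, add_mul, one_mul, mul_one, smul_mul_assoc, mul_smul_comm,
    hP]
  -- This is the coefficient of the idempotent uu* in the product; it equals |μ|⁴ - 1.
  have h : (μ ^ 2 - 1) + (star μ ^ 2 - 1) + (μ ^ 2 - 1) * (star μ ^ 2 - 1) = 0 := by
    linear_combination (μ * star μ + 1) * hμ
  refine Eq.trans (b := 1 + ((μ ^ 2 - 1) + (star μ ^ 2 - 1) + (μ ^ 2 - 1) * (star μ ^ 2 - 1)) •
    Matrix.vecMulVec u (star u)) (by module) ?_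
  rw [h, zero_smul, add_zero]

theorem star_complexReflection (u : Fin n → ℂ) (μ : ℂ) :
    star (complexReflection u μ) = complexReflection u (star μ) := by
  simp [complexReflection, Matrix.star_eq_conjTranspose, Matrix.conjTranspose_vecMulVec]

theorem complexReflection_mem_unitary (hu : star u ⬝ᵥ u = 1) (hμ : μ * star μ = 1) :
    complexReflection u μ ∈ Matrix.unitaryGroup (Fin n) ℂ := by
  rw [Matrix.mem_unitaryGroup_iff, star_complexReflection]
  exact complexReflection_mul_star hu hμ

theorem det_complexReflection (hu : star u ⬝ᵥ u = 1) : (complexReflection u μ).det = μ ^ 2 := by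
  rw [complexReflection, ← Matrix.smul_vecMulVec, Matrix.vecMulVec_eq (Fin 1),
    Matrix.det_one_add_replicateCol_mul_replicateRow, dotProduct_smul, hu, smul_eq_mul]
  ring

/-- The spin lift of a complex reflection is a product of two unit vectors. -/
theorem extMap_complexReflection (σ : Fin (2 * n) ≃ Fin n ⊕ Fin n) (hu : star u ⬝ᵥ u = 1)
    (hμ : μ * star μ = 1) :
    extMap (complexReflection u μ) = μ • cliffordAction σ
      (CliffordAlgebra.ι _ (realVec σ u) * CliffordAlgebra.ι _ (realVec σ (-star μ • u))) := by
  refine LinearMap.ext fun x => ?_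
  have hanti : contraction u (ExteriorAlgebra.ι ℂ u * x) =
      x - ExteriorAlgebra.ι ℂ u * contraction u x := by
    rw [contraction_ι_mul, hu, one_smul]
  have hsq : ExteriorAlgebra.ι ℂ u * (ExteriorAlgebra.ι ℂ u * x) = 0 := by
    rw [← mul_assoc, ExteriorAlgebra.ι_sq_zero, zero_mul]
  -- Write a for the contraction and a* for the wedge with u. Contraction is conjugate linear in its
  -- vector, so -μ̄u acts as -i(μa + μ̄a*) and u as i(a + a*). Their product is μa*a + μ̄aa*;
  -- multiplying by μ and using aa* = 1 - a*a gives 1 + (μ² - 1)a*a.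
  rw [complexReflection, extMap_one_add_vecMulVec, map_mul, cliffordAction_ι, cliffordAction_ι,
    LinearMap.smul_apply, Module.End.mul_apply, diracVec_realVec, diracVec_realVec,
    contraction_smul, (ExteriorAlgebra.ι ℂ).map_smul, smul_mul_assoc]
  simp only [map_add, map_smul, smul_add, mul_add, mul_smul_comm, contraction_contraction, hanti,
    hsq, star_neg, star_star]
  match_scalars
  · linear_combination (Complex.I * Complex.I) * hμ + Complex.I_mul_I
  · linear_combination (-Complex.I * Complex.I) * hμ + (μ ^ 2 - 1) * Complex.I_mul_I

end Reflection

/-! ### Lifting unitary matrices up to a square root of the determinant -/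

section Lift

variable {n : ℕ}

/-- Some complex reflection maps a unit vector `y` to a distinct unit vector `x` and fixes the
vectors orthogonal to both. -/
theorem exists_complexReflection_mulVec_eq {x y : Fin n → ℂ} (hx : star x ⬝ᵥ x = 1)
    (hy : star y ⬝ᵥ y = 1) (hxy : x ≠ y) :
    ∃ (u : Fin n → ℂ) (μ : ℂ), star u ⬝ᵥ u = 1 ∧ μ * star μ = 1 ∧
      (complexReflection u μ).mulVec y = x ∧
      ∀ v, star x ⬝ᵥ v = 0 → star y ⬝ᵥ v = 0 → (complexReflection u μ).mulVec v = v := by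
  set w := y - x with hw
  set z : ℂ := star w ⬝ᵥ y with hz
  have hw0 : w ≠ 0 := sub_ne_zero.2 hxy.symm
  have hzx : z = 1 - star x ⬝ᵥ y := by
    rw [hz, hw, star_sub, sub_dotProduct, hy]
  have hzs : star z = 1 - star y ⬝ᵥ x := by
    rw [hzx, star_sub, star_one, Matrix.star_dotProduct, star_star]
  have hN : star w ⬝ᵥ w = z + star z := by
    rw [hzs, hzx, hw, star_sub, sub_dotProduct, dotProduct_sub, dotProduct_sub, hx, hy]
    ring
  set N : ℝ := ∑ j, Complex.normSq (w j) with hNdef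
  have hNw : star w ⬝ᵥ w = (N : ℂ) := by
    rw [hNdef, dotProduct, Complex.ofReal_sum]
    exact Finset.sum_congr rfl fun j _ => (Complex.normSq_eq_conj_mul_self).symm
  have hNpos : 0 < N := by
    obtain ⟨j, hj⟩ := Function.ne_iff.1 hw0
    exact Finset.sum_pos' (fun i _ => Complex.normSq_nonneg _)
      ⟨j, Finset.mem_univ j, Complex.normSq_pos.2 hj⟩
  -- The squared length of w is 2 Re z, and w is nonzero.
  have hz0 : z ≠ 0 := by
    intro h
    rw [hNw, h, star_zero, add_zero] at hN
    exact hNpos.ne' (by exact_mod_cast hN)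
  have hzs0 : star z ≠ 0 := star_ne_zero.2 hz0
  set r : ℝ := (Real.sqrt N)⁻¹ with hr
  have hrN : (r : ℂ) * r * N = 1 := by
    have : r * r * N = 1 := by
      rw [hr, ← mul_inv, Real.mul_self_sqrt hNpos.le, inv_mul_cancel₀ hNpos.ne']
    exact_mod_cast this
  -- Reflecting along w/√N sends y to y + (μ² - 1)(z/N)w. This equals x = y - w exactly when (μ² -
  -- 1)z = -N = -(z + z̄), that is, μ² = -z̄/z, a number of modulus 1.
  obtain ⟨μ, hμ⟩ := IsAlgClosed.exists_pow_nat_eq (-star z / z) (n := 2) two_pos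
  have hu : ∀ v, star ((r : ℂ) • w) ⬝ᵥ v = r * (star w ⬝ᵥ v) := by
    intro v
    rw [star_smul, smul_dotProduct, Complex.star_def, Complex.conj_ofReal, smul_eq_mul]
  refine ⟨(r : ℂ) • w, μ, ?_, ?_, ?_, ?_⟩
  · rw [hu, dotProduct_smul, hNw, smul_eq_mul, ← mul_assoc, hrN]
  · have h1 : (Complex.normSq μ) ^ 2 = 1 := by
      rw [← map_pow, hμ, map_div₀, Complex.normSq_neg, Complex.star_def, Complex.normSq_conj,
        div_self (Complex.normSq_pos.2 hz0).ne']
    have h2 : Complex.normSq μ = 1 :=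
      (pow_eq_one_iff_of_nonneg (Complex.normSq_nonneg μ) two_ne_zero).1 h1
    rw [Complex.star_def, Complex.mul_conj, h2, Complex.ofReal_one]
  · have hμz : (μ ^ 2 - 1) * z = -N := by
      rw [← hNw, hN, hμ]
      field_simp
      ring
    rw [complexReflection_mulVec, hu, smul_smul, ← hz]
    have : (μ ^ 2 - 1) * (r * z) * r = -1 := by
      linear_combination (r : ℂ) * r * hμz - hrN
    rw [this, hw]
    simp
  · intro v hxv hyv
    rw [complexReflection_mulVec, hu, hw, star_sub, sub_dotProduct, hxv, hyv]
    simp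

/-- `g` acts on `Λ ℂⁿ` by a square root of `det g` times an element of the spin group. -/
def HasSpinLift (σ : Fin (2 * n) ≃ Fin n ⊕ Fin n) (g : Matrix (Fin n) (Fin n) ℂ) : Prop :=
  ∃ c : ℂ, c ^ 2 = g.det ∧ ∃ s ∈ Spin (2 * n), extMap g = c • cliffordAction σ s

variable {σ : Fin (2 * n) ≃ Fin n ⊕ Fin n}

theorem HasSpinLift.one : HasSpinLift σ 1 :=
  ⟨1, by simp, 1, one_mem _, by rw [extMap_one, map_one, one_smul]⟩

theorem HasSpinLift.mul {g h : Matrix (Fin n) (Fin n) ℂ} (hg : HasSpinLift σ g)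
    (hh : HasSpinLift σ h) : HasSpinLift σ (g * h) := by
  obtain ⟨c, hc, s, hs, hgs⟩ := hg
  obtain ⟨d, hd, t, ht, hht⟩ := hh
  refine ⟨c * d, by rw [mul_pow, hc, hd, Matrix.det_mul], s * t, mul_mem hs ht, ?_⟩
  rw [extMap_mul, hgs, hht, map_mul, smul_mul_smul_comm]

theorem hasSpinLift_complexReflection {u : Fin n → ℂ} {μ : ℂ} (hu : star u ⬝ᵥ u = 1)
    (hμ : μ * star μ = 1) : HasSpinLift σ (complexReflection u μ) := by
  refine ⟨μ, (det_complexReflection hu).symm, _, ι_mul_ι_mem_spin (negForm_realVec σ hu)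
    (negForm_realVec σ ?_), extMap_complexReflection σ hu hμ⟩
  rw [star_smul, smul_dotProduct, dotProduct_smul, hu, star_neg, star_star]
  simpa using hμ

theorem unitary_star_mulVec_dotProduct {g : Matrix (Fin n) (Fin n) ℂ}
    (hg : g ∈ Matrix.unitaryGroup (Fin n) ℂ) (v w : Fin n → ℂ) :
    star (g.mulVec v) ⬝ᵥ g.mulVec w = star v ⬝ᵥ w := by
  rw [Matrix.star_mulVec, Matrix.dotProduct_mulVec, Matrix.vecMul_vecMul,
    ← Matrix.star_eq_conjTranspose, Matrix.mem_unitaryGroup_iff'.1 hg, Matrix.vecMul_one]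

/-- Induction on the number `d` of final basis vectors that `g` may move: one complex reflection at
a time returns the first of them to its place. At `d = n` the fixing hypothesis is vacuous. -/
theorem hasSpinLift_of_fixes (σ : Fin (2 * n) ≃ Fin n ⊕ Fin n) (d : ℕ)
    (g : Matrix (Fin n) (Fin n) ℂ) (hg : g ∈ Matrix.unitaryGroup (Fin n) ℂ)
    (hfix : ∀ i : Fin n, (i : ℕ) + d < n → g.mulVec (Pi.single i 1) = Pi.single i 1) :
    HasSpinLift σ g := by
  induction d generalizing g with
  | zero =>
    have : g = 1 := by
      ext i j
      have := congrFun (hfix j (by simp)) i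
      simpa [Matrix.one_apply, Pi.single_apply] using this
    rw [this]
    exact HasSpinLift.one
  | succ d ih =>
    by_cases hd : n < d + 1
    · exact ih g hg fun i hi => by omega
    push Not at hd
    set k : Fin n := ⟨n - (d + 1), by omega⟩ with hk
    have hlt : ∀ i : Fin n, (i : ℕ) + d < n → i ≠ k → (i : ℕ) + (d + 1) < n := by
      intro i hi hik
      have : (i : ℕ) ≠ n - (d + 1) := fun h => hik (Fin.ext h)
      omega
    have hunit : star (Pi.single k 1 : Fin n → ℂ) ⬝ᵥ Pi.single k 1 = 1 := by simp
    by_cases hgk : g.mulVec (Pi.single k 1) = Pi.single k 1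
    · refine ih g hg fun i hi => ?_
      by_cases hik : i = k
      · rw [hik, hgk]
      · exact hfix i (hlt i hi hik)
    -- The reflection carries g e_k back to e_k. An earlier e_i is orthogonal to e_k and, since g is
    -- unitary and fixes e_i, also to g e_k, so the reflection leaves it fixed.
    · obtain ⟨u, μ, hu, hμ, hR, hRfix⟩ := exists_complexReflection_mulVec_eq hunit
        ((unitary_star_mulVec_dotProduct hg _ _).trans hunit) (Ne.symm hgk)
      have hμ' : star μ * star (star μ) = 1 := by rw [star_star, mul_comm, hμ]
      have hlift : HasSpinLift σ (complexReflection u μ * g) := by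
        refine ih _ (mul_mem (complexReflection_mem_unitary hu hμ) hg) fun i hi => ?_
        rw [← Matrix.mulVec_mulVec]
        by_cases hik : i = k
        · rw [hik, hR]
        · have horth : star (Pi.single k 1 : Fin n → ℂ) ⬝ᵥ Pi.single i 1 = 0 := by
            simp [Ne.symm hik]
          have hgi := hfix i (hlt i hi hik)
          rw [hgi]
          refine hRfix _ horth ?_
          conv_lhs => rw [← hgi]
          rw [unitary_star_mulVec_dotProduct hg, horth]
      -- The reflection with parameter μ̄ is the inverse one, which recovers g.
      have h := (hasSpinLift_complexReflection (σ := σ) hu hμ').mul hlift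
      have hinv := complexReflection_mul_star hu hμ'
      rw [star_star] at hinv
      rwa [← mul_assoc, hinv, one_mul] at h

theorem exists_spin_of_mem_specialUnitary (σ : Fin (2 * n) ≃ Fin n ⊕ Fin n)
    {g : Matrix (Fin n) (Fin n) ℂ} (hg : g ∈ Matrix.specialUnitaryGroup (Fin n) ℂ) :
    ∃ s ∈ Spin (2 * n), cliffordAction σ s = extMap g := by
  -- For n = 0 there is no unit vector whose square would provide -1, but the only matrix is the
  -- identity.
  rcases isEmpty_or_nonempty (Fin n) with hn | ⟨⟨j⟩⟩
  · refine ⟨1, one_mem _, ?_⟩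
    rw [map_one, Subsingleton.elim g 1, extMap_one]
  obtain ⟨c, hc, s, hs, hgs⟩ := hasSpinLift_of_fixes σ n g hg.1 fun i hi => by omega
  rw [show g.det = 1 from hg.2] at hc
  rcases sq_eq_one_iff.1 hc with rfl | rfl
  · exact ⟨s, hs, by rw [hgs, one_smul]⟩
  · have hunit : star (Pi.single j 1 : Fin n → ℂ) ⬝ᵥ Pi.single j 1 = 1 := by simp
    refine ⟨-1 * s, mul_mem (neg_one_mem_spin (negForm_realVec σ hunit)) hs, ?_⟩
    rw [hgs, map_mul, map_neg, map_one]
    exact (neg_one_mul (cliffordAction σ s)).trans (neg_one_smul ℂ (cliffordAction σ s)).symm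

end Lift

/-! ### Smoothness of the induced operators -/

section Smooth

variable {n : ℕ}

open scoped Matrix.Norms.Elementwise in
-- The image of v∧a is gv∧(image of a), so by induction each coordinate is a polynomial in the real
-- and imaginary parts of the entries of g. The functional `l` varies because the inductive step
-- precomposes it with creation operators.
theorem contDiff_extMap_apply (z : ExtAlg n) (l : Module.Dual ℝ (ExtAlg n)) :
    ContDiff ℝ ∞ fun g : Matrix (Fin n) (Fin n) ℂ => l (extMap g z) := by
  induction z using CliffordAlgebra.left_induction generalizing l with
  | algebraMap r =>
    have : (fun g : Matrix (Fin n) (Fin n) ℂ => l (extMap g (algebraMap ℂ (ExtAlg n) r))) =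
        fun _ => l (algebraMap ℂ (ExtAlg n) r) := funext fun g => by rw [extMap_algebraMap]
    exact this ▸ contDiff_const
  | add a b ha hb =>
    simp only [map_add]
    exact (ha l).add (hb l)
  | ι_mul a v ha =>
    have hexp : ∀ g : Matrix (Fin n) (Fin n) ℂ,
        l (extMap g (ExteriorAlgebra.ι ℂ v * a)) =
          ∑ j, ((g.mulVec v j).re * l (creation j (extMap g a)) +
            (g.mulVec v j).im * l (Complex.I • creation j (extMap g a))) := by
      intro g
      rw [extMap_ι_mul, ι_mul_eq_sum_creation, map_sum]
      refine Finset.sum_congr rfl fun j _ => ?_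
      conv_lhs => rw [← Complex.re_add_im (g.mulVec v j)]
      rw [add_smul, mul_smul, map_add, Complex.coe_smul, Complex.coe_smul, map_smul, map_smul,
        smul_eq_mul, smul_eq_mul]
    have hcoord : ∀ (m : ℂ →ₗ[ℝ] ℝ) (j : Fin n),
        ContDiff ℝ ∞ fun g : Matrix (Fin n) (Fin n) ℂ => m (g.mulVec v j) := by
      intro m j
      let f : Matrix (Fin n) (Fin n) ℂ →ₗ[ℝ] ℝ :=
        { toFun := fun g => m (g.mulVec v j)
          map_add' := fun g h => by rw [Matrix.add_mulVec, Pi.add_apply, map_add]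
          map_smul' := fun r g => by
            rw [Matrix.smul_mulVec, Pi.smul_apply, map_smul, RingHom.id_apply] }
      exact f.toContinuousLinearMap.contDiff
    refine (funext hexp : (fun g : Matrix (Fin n) (Fin n) ℂ =>
      l (extMap g (ExteriorAlgebra.ι ℂ v * a))) = _) ▸ ContDiff.sum fun j _ => ?_
    exact ((hcoord Complex.reLm j).mul (ha (l ∘ₗ (creation j).restrictScalars ℝ))).add
      ((hcoord Complex.imLm j).mul (ha (l ∘ₗ (Complex.I • creation j).restrictScalars ℝ)))

open scoped Matrix.Norms.Elementwise in
theorem contDiff_extMap (l : Module.Dual ℝ (Module.End ℂ (ExtAlg n))) :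
    ContDiff ℝ ∞ fun g : Matrix (Fin n) (Fin n) ℂ => l (extMap g) := by
  let m : Finset (Fin n) → Module.Dual ℝ (ExtAlg n) := fun S =>
    l ∘ₗ (LinearMap.smulRightₗ ((extBasis n).coord S)).restrictScalars ℝ
  have h : ∀ g : Matrix (Fin n) (Fin n) ℂ,
      l (extMap g) = ∑ S, m S (extMap g (extBasis n S)) := by
    intro g
    conv_lhs => rw [end_eq_sum_smulRight (extMap g), map_sum]
    rfl
  rw [funext h]
  exact ContDiff.sum fun S _ => contDiff_extMap_apply _ _

end Smooth

/-! ### Assembling the Lie group homomorphism -/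

open scoped Matrix.Norms.Elementwise in
/-- The natural representation of `SU(n)` lifts through the Dirac spinor representation. -/
theorem exists_lieGroupHom_comp_eq_natRep (n : ℕ) (σ : Fin (2 * n) ≃ Fin n ⊕ Fin n) :
    ∃ ψ : Matrix.specialUnitaryGroup (Fin n) ℂ →* Spin (2 * n),
      IsLieGroupHom ψ ∧ (diracRep σ).comp ψ = natRep n := by
  choose s hs hact using fun g : Matrix.specialUnitaryGroup (Fin n) ℂ =>
    exists_spin_of_mem_specialUnitary σ g.2
  have hinj := cliffordAction_injective σ
  let ψ : Matrix.specialUnitaryGroup (Fin n) ℂ →* Spin (2 * n) :=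
    { toFun := fun g => ⟨s g, hs g⟩
      map_one' := Subtype.ext <| hinj <| by
        rw [hact, Submonoid.coe_one, Submonoid.coe_one, extMap_one, map_one]
      map_mul' := fun g h => Subtype.ext <| hinj <| by
        rw [hact, Submonoid.coe_mul, Submonoid.coe_mul, extMap_mul, map_mul, hact, hact] }
  refine ⟨ψ, fun g => ⟨Set.univ, isOpen_univ, Set.mem_univ _, ?_⟩, ?_⟩
  -- With `L` a real-linear left inverse of the Clifford action, `L (extMap x)` extends the lift
  -- smoothly to the whole matrix space.
  · obtain ⟨L, hL⟩ := LinearMap.exists_leftInverse_of_injective (cliffordAction σ).toLinearMap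
      (LinearMap.ker_eq_bot.2 hinj)
    refine ⟨fun x => L (extMap x), fun l => (contDiff_extMap (l ∘ₗ L)).contDiffOn, fun x _ => ?_⟩
    change L (extMap (x : Matrix (Fin n) (Fin n) ℂ)) = s x
    rw [← hact]
    exact LinearMap.congr_fun hL (s x)
  · ext1 g
    exact Subtype.ext (Units.ext (hact g))

end SpinorRep

theorem theorem2 (n : ℕ) (σ : Fin (2 * n) ≃ Fin n ⊕ Fin n) :
    ∃ ψ : Matrix.specialUnitaryGroup (Fin n) ℂ →* SpinorRep.Spin (2 * n),
      SpinorRep.IsLieGroupHom ψ ∧ (SpinorRep.diracRep σ).comp ψ = SpinorRep.natRep n :=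
  SpinorRep.exists_lieGroupHom_comp_eq_natRep n σ
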